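/- The cover graph of a finite poset $P$ is the simple graph whose vertices are the elements of $P$ and in which two elements are adjacent if and only if one of them covers the other in $P$. The dimension of $P$ is the least non-negative integer $d$ such that the partial order of $P$ is the intersection of $d$ linear orders on the ground set of $P$. Every finite poset whose cover graph has treewidth at most $2$ has dimension at most $12$. -/

import Mathlib

/-- A tree-decomposition of a graph `G`: a finite tree together with a family of subsets of the
vertex set (the bags), indexed by the nodes of the tree. -/
structure TreeDecomposition {V : Type*} (G : SimpleGraph V) where
  /-- The nodes of the tree. -/
  Node : Type
  finite_node : Finite Node
  /-- The underlying tree. -/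
  tree : SimpleGraph Node
  isTree : tree.IsTree
  /-- The bags. -/
  bag : Node → Set V
  /-- Every vertex lies in a bag. -/
  exists_mem_bag : ∀ x : V, ∃ u : Node, x ∈ bag u
  /-- Both ends of every edge lie in a common bag. -/
  exists_edge_bag : ∀ x y : V, G.Adj x y → ∃ u : Node, x ∈ bag u ∧ y ∈ bag u
  /-- If `v` lies on the path between `u₁` and `u₂`, then every vertex common to the bags of `u₁`
  and `u₂` is in the bag of `v`. -/
  inter_subset_bag : ∀ (u₁ u₂ v : Node) (p : tree.Walk u₁ u₂), p.IsPath → v ∈ p.support →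
    bag u₁ ∩ bag u₂ ⊆ bag v

/-- The width of a tree-decomposition: the maximum of `|Y| - 1` over its bags `Y`. The subtraction
is truncated, which only matters for the graph without vertices. -/
noncomputable def TreeDecomposition.width {V : Type*} {G : SimpleGraph V}
    (D : TreeDecomposition G) : ℕ∞ :=
  ⨆ u : D.Node, ((D.bag u).encard - 1)

/-- The treewidth of a graph: the least width of a tree-decomposition (`⊤` if there is none of
finite width, which does not happen for a finite graph). -/
noncomputable def treewidth {V : Type*} (G : SimpleGraph V) : ℕ∞ :=
  ⨅ D : TreeDecomposition G, D.width

/-- The order of `P` is the intersection of `d` linear orders on `P`. -/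
def IsIntersectionOfLinearOrders (P : Type*) [PartialOrder P] (d : ℕ) : Prop :=
  ∃ L : Fin d → LinearOrder P, ∀ x y : P, x ≤ y ↔ ∀ i : Fin d, (L i).le x y

/-- The dimension of a poset `P`: the least `d` such that the order of `P` is the intersection of
`d` linear orders (`⊤` if there is no such `d`, which does not happen for a finite poset). -/
noncomputable def posetDimension (P : Type*) [PartialOrder P] : ℕ∞ :=
  ⨅ (d : ℕ) (_ : IsIntersectionOfLinearOrders P d), (d : ℕ∞)

/-! A graph of treewidth at most 2 lies in a 2-tree, and in a rooted 2-tree the subtree of a vertex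
(for the map `parent`) is cut off from the rest by the two ends of the edge that the vertex is
attached to. Hanging one new leaf below and one above each element turns `a ≤ b` into a
comparability between a lower leaf `x` and an upper leaf `y`. It remains to reverse the pairs `x ≰
y` of such leaves. One linear extension reverses any set of pairs without alternating cycles
(`exists_linearOrder_reversing`), so twelve such sets covering all pairs suffice.

The trap of `x` is the deepest ancestor `a` of `x` such that `x` is below neither end of the edge of
`a`; everything above `x` stays in its subtree. Up to duality, either `y` is outside this subtree or
an end of the edge of `a` is below `y` (`exists_trap_cases`). Outside pairs are split by the
direction from `x` to `y` in an order `ψ` with convex subtrees (`not_alternatingCycle_outsidePair`).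

Inside pairs are split by this direction and also by an orientation at the trap, read off from a
real labelling `φ` that puts each vertex between the ends of its edge. This orientation propagates
down to every edge that has one end above `x` and the other below `y` (`InsideData.lt_of_split`). In
a shortest alternating cycle, it prevents a jump between two branches at the meet of the `y i` from
ever being undone (`not_alternatingCycle_insidePair`). This gives 2 + 4 sets, doubled by duality. -/

/-- A 2-tree with a root edge `{first, second}`, in which every other vertex is attached to an edge
`{parent v, coparent v}` of earlier vertices; `index` is an order in which the vertices can be
attached. -/
structure RootedTwoTree (V : Type*) where
  first : V
  second : V
  parent : V → V
  coparent : V → V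
  index : V → ℕ
  index_injective : Function.Injective index
  first_ne_second : first ≠ second
  index_parent_lt : ∀ v, v ≠ first → v ≠ second → index (parent v) < index v
  index_coparent_lt : ∀ v, v ≠ first → v ≠ second → index (coparent v) < index v
  parent_cases : ∀ v, v ≠ first → v ≠ second →
    (parent v = second ∧ coparent v = first) ∨
    ((parent v ≠ first ∧ parent v ≠ second) ∧
      (coparent v = parent (parent v) ∨ coparent v = coparent (parent v)))

/-! ### Descendants in a rooted 2-tree -/

namespace RootedTwoTree

variable {V : Type*} (S : RootedTwoTree V)

/-- The vertices that are not on the root edge. -/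
def Inner (v : V) : Prop := v ≠ S.first ∧ v ≠ S.second

/-- `S.Desc u v`: the vertex `v` is a descendant of `u` in the tree of the map `parent`. -/
def Desc (u v : V) : Prop :=
  Relation.ReflTransGen (fun a b => S.Inner b ∧ S.parent b = a) u v

variable {S}

lemma Desc.refl (u : V) : S.Desc u u := Relation.ReflTransGen.refl

lemma Desc.trans {u v w : V} (h : S.Desc u v) (h' : S.Desc v w) : S.Desc u w :=
  Relation.ReflTransGen.trans h h'

lemma desc_parent {v : V} (hv : S.Inner v) : S.Desc (S.parent v) v :=
  Relation.ReflTransGen.single ⟨hv, rfl⟩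

lemma Desc.index_le {u v : V} (h : S.Desc u v) : S.index u ≤ S.index v := by
  induction h with
  | refl => exact le_rfl
  | tail _ h ih =>
    obtain ⟨h1, rfl⟩ := h
    exact ih.trans (S.index_parent_lt _ h1.1 h1.2).le

lemma Desc.antisymm {u v : V} (h : S.Desc u v) (h' : S.Desc v u) : u = v :=
  S.index_injective (le_antisymm h.index_le h'.index_le)

lemma Desc.eq_of_index_le {u v : V} (h : S.Desc u v) (h' : S.index v ≤ S.index u) : u = v :=
  S.index_injective (le_antisymm h.index_le h')

lemma Desc.index_lt {u v : V} (h : S.Desc u v) (h' : v ≠ u) : S.index u < S.index v :=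
  lt_of_not_ge fun hle => h' (h.eq_of_index_le hle).symm

lemma Desc.exists_child {u v : V} (h : S.Desc u v) (hne : v ≠ u) :
    ∃ w, S.Inner w ∧ S.parent w = u ∧ S.Desc w v := by
  rcases Relation.ReflTransGen.cases_head h with h | ⟨w, h1, h2⟩
  · exact absurd h.symm hne
  · exact ⟨w, h1.1, h1.2, h2⟩

lemma Desc.inner_right {u v : V} (h : S.Desc u v) (hu : S.Inner u) : S.Inner v := by
  rcases Relation.ReflTransGen.cases_tail h with h | ⟨w, _, h2⟩
  · exact h ▸ hu
  · exact h2.1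

lemma Desc.to_parent {u v : V} (h : S.Desc u v) (hne : v ≠ u) :
    S.Inner v ∧ S.Desc u (S.parent v) := by
  rcases Relation.ReflTransGen.cases_tail h with h | ⟨w, h1, h2⟩
  · exact absurd h hne
  · exact ⟨h2.1, h2.2 ▸ h1⟩

lemma Desc.total {u u' v : V} (h : S.Desc u v) (h' : S.Desc u' v) : S.Desc u u' ∨ S.Desc u' u := by
  induction h with
  | refl => exact Or.inr h'
  | @tail b c h1 h2 ih =>
    obtain ⟨h2, rfl⟩ := h2
    by_cases hu : u' = c
    · subst hu
      exact Or.inl (h1.tail ⟨h2, rfl⟩)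
    · exact ih (h'.to_parent (Ne.symm hu)).2

lemma Desc.of_index_le {u u' v : V} (h : S.Desc u v) (h' : S.Desc u' v)
    (hi : S.index u ≤ S.index u') : S.Desc u u' := by
  rcases h.total h' with h1 | h1
  · exact h1
  · rw [h1.eq_of_index_le hi]
    exact Desc.refl _

lemma child_unique {u v w y : V} (hv : S.Inner v) (hw : S.Inner w) (hpv : S.parent v = u)
    (hpw : S.parent w = u) (hvy : S.Desc v y) (hwy : S.Desc w y) : v = w := by
  by_contra hne
  rcases hvy.total hwy with h | h
  · have h1 := (h.to_parent (Ne.symm hne)).2.index_le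
    have h2 := S.index_parent_lt v hv.1 hv.2
    rw [hpw] at h1
    rw [hpv] at h2
    omega
  · have h1 := (h.to_parent hne).2.index_le
    have h2 := S.index_parent_lt w hw.1 hw.2
    rw [hpv] at h1
    rw [hpw] at h2
    omega

lemma not_desc_parent {v w : V} (hv : S.Inner v) (h : S.Desc v w) : ¬ S.Desc w (S.parent v) :=
  fun h' => by
    have := (h.trans h').index_le
    have := S.index_parent_lt v hv.1 hv.2
    omega

lemma not_desc_coparent {v w : V} (hv : S.Inner v) (h : S.Desc v w) : ¬ S.Desc w (S.coparent v) :=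
  fun h' => by
    have := (h.trans h').index_le
    have := S.index_coparent_lt v hv.1 hv.2
    omega

lemma coparent_of_inner_parent {v : V} (hv : S.Inner v) (hp : S.Inner (S.parent v)) :
    S.coparent v = S.parent (S.parent v) ∨ S.coparent v = S.coparent (S.parent v) := by
  rcases S.parent_cases v hv.1 hv.2 with h | h
  · exact absurd h.1 hp.2
  · exact h.2

/-- A coparent is the grandparent or is inherited from the parent, so it too is found on the way up
the tree. -/
lemma desc_coparent {v : V} (hv : S.Inner v) (hq : S.Inner (S.coparent v)) :
    S.Desc (S.coparent v) v := by
  induction hn : S.index v using Nat.strong_induction_on generalizing v with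
  | _ n ih =>
    subst hn
    rcases S.parent_cases v hv.1 hv.2 with h | ⟨hp, h⟩
    · exact absurd h.2 hq.1
    · refine Desc.trans ?_ (desc_parent hv)
      rcases h with h | h
      · rw [h]
        exact desc_parent hp
      · rw [h] at hq ⊢
        exact ih _ (S.index_parent_lt v hv.1 hv.2) hp hq rfl

lemma Desc.parent_mem {v z : V} (h : S.Desc v z) :
    S.Desc v (S.parent z) ∨ S.parent z = S.parent v := by
  by_cases hz : z = v
  · exact Or.inr (hz ▸ rfl)
  · exact Or.inl (h.to_parent hz).2

/-- One level further down, the coparent is the grandparent or is inherited, so a subtree touches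
the rest only in the ends of the edge of its root. -/
lemma Desc.coparent_mem {v z : V} (hv : S.Inner v) (h : S.Desc v z) :
    S.Desc v (S.coparent z) ∨ S.coparent z = S.parent v ∨ S.coparent z = S.coparent v := by
  induction h with
  | refl => exact Or.inr (Or.inr rfl)
  | tail h1 h2 ih =>
    obtain ⟨h2, rfl⟩ := h2
    have hp := Desc.inner_right h1 hv
    rcases coparent_of_inner_parent h2 hp with h | h
    · rw [h]
      rcases Desc.parent_mem h1 with h | h
      · exact Or.inl h
      · exact Or.inr (Or.inl h)
    · rw [h]
      exact ih

/-! ### Reachability through separating edges, and traps -/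

/-- `S.Adj u v`: one of the two vertices is attached to an edge containing the other. -/
def Adj (S : RootedTwoTree V) (u v : V) : Prop :=
  S.Inner u ∧ S.Inner v ∧
    ((v = S.parent u ∨ v = S.coparent u) ∨ (u = S.parent v ∨ u = S.coparent v))

lemma Adj.symm {u v : V} (h : S.Adj u v) : S.Adj v u := ⟨h.2.1, h.1, h.2.2.symm⟩

lemma Adj.exit {v z z' : V} (hv : S.Inner v) (h : S.Adj z z') (hz : S.Desc v z)
    (hz' : ¬ S.Desc v z') : z' = S.parent v ∨ z' = S.coparent v := by
  obtain ⟨h1, h2, (rfl | rfl) | (rfl | rfl)⟩ := h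
  · rcases hz.parent_mem with h | h
    · exact absurd h hz'
    · exact Or.inl h
  · rcases hz.coparent_mem hv with h | h
    · exact absurd h hz'
    · exact h
  · exact absurd (hz.trans (desc_parent h2)) hz'
  · exact absurd (hz.trans (desc_coparent h2 h1)) hz'

/-- A reachability relation along edges of a rooted 2-tree that avoids the root edge. -/
structure Separated (S : RootedTwoTree V) (le : V → V → Prop) : Prop where
  refl : ∀ x, le x x
  trans : ∀ {x y z}, le x y → le y z → le x z
  not_first : ∀ {x}, S.Inner x → ¬ le x S.first
  not_second : ∀ {x}, S.Inner x → ¬ le x S.second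
  first_not : ∀ {x}, S.Inner x → ¬ le S.first x
  second_not : ∀ {x}, S.Inner x → ¬ le S.second x
  exit : ∀ {v x y}, S.Inner v → S.Desc v x → ¬ S.Desc v y → le x y →
    (le x (S.parent v) ∧ le (S.parent v) y) ∨ (le x (S.coparent v) ∧ le (S.coparent v) y)
  enter : ∀ {v x y}, S.Inner v → ¬ S.Desc v x → S.Desc v y → le x y →
    (le x (S.parent v) ∧ le (S.parent v) y) ∨ (le x (S.coparent v) ∧ le (S.coparent v) y)

/-- This symmetry transfers every result on `le` to the reversed order, which supplies six of the
twelve sets. -/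
lemma Separated.dual {le : V → V → Prop} (h : S.Separated le) :
    S.Separated (fun x y => le y x) where
  refl := h.refl
  trans h1 h2 := h.trans h2 h1
  not_first := h.first_not
  not_second := h.second_not
  first_not := h.not_first
  second_not := h.not_second
  exit hv hx hy hxy := (h.enter hv hy hx hxy).imp And.symm And.symm
  enter hv hx hy hxy := (h.exit hv hy hx hxy).imp And.symm And.symm

lemma exists_exit_of_reflTransGen {E : V → V → Prop} {A : V → Prop} {x y : V}
    (h : Relation.ReflTransGen E x y) (hx : A x) (hy : ¬ A y) :
    ∃ z z', Relation.ReflTransGen E x z ∧ E z z' ∧ Relation.ReflTransGen E z' y ∧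
      A z ∧ ¬ A z' := by
  induction h with
  | refl => exact absurd hx hy
  | @tail b c h1 h2 ih =>
    by_cases hb : A b
    · exact ⟨b, c, h1, h2, Relation.ReflTransGen.refl, hb, hy⟩
    · obtain ⟨z, z', h3, h4, h5, h6⟩ := ih hb
      exact ⟨z, z', h3, h4, h5.tail h2, h6⟩

lemma separated_reflTransGen {E : V → V → Prop} (hE : ∀ x y, E x y → S.Adj x y) :
    S.Separated (Relation.ReflTransGen E) where
  refl _ := Relation.ReflTransGen.refl
  trans h1 h2 := Relation.ReflTransGen.trans h1 h2
  not_first hx h := by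
    rcases Relation.ReflTransGen.cases_tail h with h | ⟨z, _, h⟩
    · exact hx.1 h.symm
    · exact (hE _ _ h).2.1.1 rfl
  not_second hx h := by
    rcases Relation.ReflTransGen.cases_tail h with h | ⟨z, _, h⟩
    · exact hx.2 h.symm
    · exact (hE _ _ h).2.1.2 rfl
  first_not hx h := by
    rcases Relation.ReflTransGen.cases_head h with h | ⟨z, h, _⟩
    · exact hx.1 h.symm
    · exact (hE _ _ h).1.1 rfl
  second_not hx h := by
    rcases Relation.ReflTransGen.cases_head h with h | ⟨z, h, _⟩
    · exact hx.2 h.symm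
    · exact (hE _ _ h).1.2 rfl
  exit {v x y} hv hx hy hxy := by
    obtain ⟨z, z', h1, h2, h3, h4, h5⟩ := exists_exit_of_reflTransGen (A := S.Desc v) hxy hx hy
    rcases (hE _ _ h2).exit hv h4 h5 with rfl | rfl
    · exact Or.inl ⟨h1.tail h2, h3⟩
    · exact Or.inr ⟨h1.tail h2, h3⟩
  enter {v x y} hv hx hy hxy := by
    obtain ⟨z, z', h1, h2, h3, h4, h5⟩ :=
      exists_exit_of_reflTransGen (A := fun z => ¬ S.Desc v z) hxy hx (not_not.2 hy)
    rcases (hE _ _ h2).symm.exit hv (not_not.1 h5) h4 with rfl | rfl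
    · exact Or.inl ⟨h1, h3.head h2⟩
    · exact Or.inr ⟨h1, h3.head h2⟩

/-- `a` is the deepest vertex such that `x` is in the subtree of `a` and below neither of the two
vertices separating this subtree from the rest. -/
structure Trap (S : RootedTwoTree V) (le : V → V → Prop) (a x : V) : Prop where
  inner : S.Inner a
  desc : S.Desc a x
  not_parent : ¬ le x (S.parent a)
  not_coparent : ¬ le x (S.coparent a)
  deepest : ∀ {u}, S.Desc a u → u ≠ a → S.Desc u x → le x (S.parent u) ∨ le x (S.coparent u)

lemma exists_trap {le : V → V → Prop} (hle : S.Separated le) {x : V} (hx : S.Inner x) :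
    ∃ a, S.Trap le a x := by
  classical
  let A : ℕ → Prop := fun k => ∃ u, S.index u = k ∧ S.Inner u ∧ S.Desc u x ∧
    ¬ le x (S.parent u) ∧ ¬ le x (S.coparent u)
  -- The topmost ancestor is attached to the root edge, whose ends are incomparable to all inner
  -- vertices; it is a first candidate for the trap.
  have htop : ∀ n (z : V), S.index z = n → S.Inner z →
      ∃ u, S.Inner u ∧ S.Desc u z ∧ S.parent u = S.second ∧ S.coparent u = S.first := by
    intro n
    induction n using Nat.strong_induction_on with
    | _ n ih =>
      rintro z rfl hz
      rcases S.parent_cases z hz.1 hz.2 with h | ⟨hp, _⟩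
      · exact ⟨z, hz, Desc.refl z, h⟩
      · obtain ⟨u, h1, h2, h3⟩ := ih _ (S.index_parent_lt z hz.1 hz.2) _ rfl hp
        exact ⟨u, h1, h2.trans (desc_parent hz), h3⟩
  obtain ⟨u, h1, h2, h3, h4⟩ := htop _ x rfl hx
  have hA : A (S.index u) :=
    ⟨u, rfl, h1, h2, by rw [h3]; exact hle.not_second hx, by rw [h4]; exact hle.not_first hx⟩
  -- Indices increase down the tree, so the candidate of largest index is the deepest.
  obtain ⟨a, h5, h6, h7, h8, h9⟩ := Nat.findGreatest_spec (P := A) h2.index_le hA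
  refine ⟨a, h6, h7, h8, h9, fun {w} hw hne hwx => ?_⟩
  by_contra hcon
  rw [not_or] at hcon
  have : A (S.index w) := ⟨w, rfl, hw.inner_right h6, hwx, hcon.1, hcon.2⟩
  have := Nat.le_findGreatest hwx.index_le this
  have := hw.index_lt hne
  omega

/-- The child of `a` towards `x` is attached to `a` and to an end of the edge of `a`. By depth `x`
is below one of these two, and the latter is excluded. -/
lemma Trap.le {le : V → V → Prop} (hle : S.Separated le) {a x : V} (h : S.Trap le a x) :
    le x a := by
  by_cases hx : x = a
  · rw [hx]
    exact hle.refl a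
  · obtain ⟨v, hv, rfl, hvx⟩ := h.desc.exists_child hx
    have hne : v ≠ S.parent v := fun h => by
      have := S.index_parent_lt v hv.1 hv.2
      rw [← h] at this
      omega
    rcases h.deepest (desc_parent hv) hne hvx with h' | h'
    · exact h'
    · rcases coparent_of_inner_parent hv h.inner with h1 | h1
      · exact absurd (h1 ▸ h') h.not_parent
      · exact absurd (h1 ▸ h') h.not_coparent

lemma Trap.desc_of_le {le : V → V → Prop} (hle : S.Separated le) {a x y : V} (h : S.Trap le a x)
    (hxy : le x y) : S.Desc a y := by
  by_contra hy
  rcases hle.exit h.inner h.desc hy hxy with h' | h'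
  · exact h.not_parent h'.1
  · exact h.not_coparent h'.1

/-- Vertices `u` below the trap of `x` that have `x` or something above `x` in their subtrees are
attached to an edge with an end above `x`. -/
lemma Trap.le_parents {le : V → V → Prop} (hle : S.Separated le) {a x u y : V}
    (h : S.Trap le a x) (hu : S.Desc a u) (hne : u ≠ a) (hy : S.Desc u y) (hxy : le x y) :
    le x (S.parent u) ∨ le x (S.coparent u) := by
  by_cases hux : S.Desc u x
  · exact h.deepest hu hne hux
  · exact (hle.enter (hu.inner_right h.inner) hux hy hxy).imp And.left And.left

end RootedTwoTree

/-! ### Alternating cycles -/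

/-- `x` and `y` form an alternating cycle of length `n` of pairs in `C`, continued periodically. -/
structure AlternatingCycle {V : Type*} (le C : V → V → Prop) (n : ℕ) (x y : ℕ → V) : Prop where
  pos : 0 < n
  left_periodic : ∀ i, x (i + n) = x i
  right_periodic : ∀ i, y (i + n) = y i
  mem : ∀ i, C (x i) (y i)
  le_succ : ∀ i, le (x i) (y (i + 1))

namespace AlternatingCycle

variable {V : Type*} {le C : V → V → Prop} {n : ℕ} {x y : ℕ → V}

lemma shift (h : AlternatingCycle le C n x y) (k : ℕ) :
    AlternatingCycle le C n (fun i => x (i + k)) (fun i => y (i + k)) where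
  pos := h.pos
  left_periodic i := by rw [show i + n + k = i + k + n by ring, h.left_periodic]
  right_periodic i := by rw [show i + n + k = i + k + n by ring, h.right_periodic]
  mem i := h.mem _
  le_succ i := by rw [show i + 1 + k = i + k + 1 by ring]; exact h.le_succ _

lemma right_periodic_mul (h : AlternatingCycle le C n x y) (i k : ℕ) : y (i + k * n) = y i := by
  induction k with
  | zero => simp
  | succ k ih => rw [show i + (k + 1) * n = i + k * n + n by ring, h.right_periodic, ih]

/-- A property of the `y i` that is inherited by successors holds throughout the cycle. -/
lemma forall_right (h : AlternatingCycle le C n x y) {A : V → Prop} {k : ℕ} (hk : A (y k))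
    (hA : ∀ i, k ≤ i → A (y i) → A (y (i + 1))) (i : ℕ) : A (y i) := by
  have h1 : ∀ j, k ≤ j → A (y j) := fun j hj => Nat.le_induction hk hA j hj
  rw [← h.right_periodic_mul i k]
  exact h1 _ (by nlinarith [h.pos])

/-- A shortcut in an alternating cycle gives a shorter one. -/
lemma of_shortcut (h : AlternatingCycle le C n x y) {j : ℕ} (hj : 1 ≤ j) (hle : le (x j) (y 1)) :
    AlternatingCycle le C j (fun i => x (i % j + 1)) (fun i => y (i % j + 1)) where
  pos := hj
  left_periodic i := by simp
  right_periodic i := by simp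
  mem i := h.mem _
  le_succ i := by
    have hlt := Nat.mod_lt i hj
    by_cases hi : i % j + 1 = j
    · have : (i + 1) % j = 0 := by rw [Nat.add_mod, ← Nat.mod_add_mod]; simp [hi]
      simp only [this, hi]
      exact hle
    · have : (i + 1) % j = i % j + 1 := by
        rw [← Nat.mod_add_mod]
        exact Nat.mod_eq_of_lt (by omega)
      simp only [this]
      exact h.le_succ _

lemma exists_minimal (h : AlternatingCycle le C n x y) :
    ∃ m x y, AlternatingCycle le C m x y ∧
      ∀ m' x' y', AlternatingCycle le C m' x' y' → m ≤ m' := by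
  classical
  have hex : ∃ m, ∃ x y, AlternatingCycle le C m x y := ⟨n, x, y, h⟩
  obtain ⟨x, y, hxy⟩ := Nat.find_spec hex
  exact ⟨Nat.find hex, x, y, hxy, fun m' x' y' h' => Nat.find_min' hex ⟨x', y', h'⟩⟩

/-- A function into a linear order cannot decrease along an alternating cycle. -/
lemma exists_not_lt (h : AlternatingCycle le C n x y) {α : Type*} [LinearOrder α] (ψ : V → α) :
    ∃ i, ψ (y i) ≤ ψ (y (i + 1)) := by
  by_contra! hcon
  have : StrictAnti fun i => ψ (y i) := strictAnti_nat_of_succ_lt hcon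
  have := this h.pos
  simp only at this
  rw [show n = 0 + n by ring, h.right_periodic] at this
  exact lt_irrefl _ this

lemma exists_min (h : AlternatingCycle le C n x y) {α : Type*} [LinearOrder α] (f : V → α) :
    ∃ k, ∀ i, f (y k) ≤ f (y i) := by
  obtain ⟨k, _, hk⟩ := Finset.exists_min_image (Finset.range n) (fun i => f (y i))
    ⟨0, Finset.mem_range.2 h.pos⟩
  refine ⟨k, fun i => ?_⟩
  have h1 := hk (i % n) (Finset.mem_range.2 (Nat.mod_lt _ h.pos))
  have h2 := h.right_periodic_mul (i % n) (i / n)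
  rw [Nat.mod_add_div'] at h2
  rwa [h2]

end AlternatingCycle

/-! ### Outside pairs and inside pairs -/

namespace RootedTwoTree

variable {V : Type*} {S : RootedTwoTree V} {le : V → V → Prop}

/-- The subtrees are convex in the linear order given by `ψ`. -/
def ConvexSubtrees {α : Type*} [LinearOrder α] (S : RootedTwoTree V) (ψ : V → α) : Prop :=
  ∀ u x y z, S.Inner u → S.Desc u x → S.Desc u z → ψ x < ψ y → ψ y < ψ z → S.Desc u y

/-- The value of every vertex lies strictly between those of the ends of the edge that it is
attached to. -/
def Between (S : RootedTwoTree V) (φ : V → ℝ) : Prop :=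
  ∀ v, S.Inner v → (φ (S.parent v) < φ v ∧ φ v < φ (S.coparent v)) ∨
    (φ (S.coparent v) < φ v ∧ φ v < φ (S.parent v))

/-- The pairs `(x, y)` with `x ≰ y` where `y` lies outside of the trap of `x`. -/
structure OutsidePair {α : Type*} [LinearOrder α] (S : RootedTwoTree V) (le : V → V → Prop)
    (ψ : V → α) (x y : V) : Prop where
  lt : ψ x < ψ y
  outside : ∃ a, S.Trap le a x ∧ ¬ S.Desc a y

/-- Somewhere `ψ (y i) ≤ ψ (y (i + 1))`. Then `y i` is caught between `x i` and `y (i + 1)`, or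
equals the latter; both are in the trap of `x i`, hence so is `y i`, by convexity. -/
lemma not_alternatingCycle_outsidePair {α : Type*} [LinearOrder α] (hle : S.Separated le)
    {ψ : V → α} (hψ : S.ConvexSubtrees ψ) (hinj : Function.Injective ψ) (n : ℕ) (x y : ℕ → V) :
    ¬ AlternatingCycle le (S.OutsidePair le ψ) n x y := by
  intro h
  obtain ⟨i, hi⟩ := h.exists_not_lt ψ
  obtain ⟨a, ha, hay⟩ := (h.mem i).outside
  have h1 := ha.desc_of_le hle (h.le_succ i)
  rcases hi.lt_or_eq with hi | hi
  · exact hay (hψ a _ _ _ ha.inner ha.desc h1 (h.mem i).lt hi)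
  · exact hay (hinj hi ▸ h1)

/-- `a` is the trap of `x`, the leaf `y` is below its child `v` and has elements of the edge of
`a` below it. -/
structure InsideData (S : RootedTwoTree V) (le : V → V → Prop) (φ : V → ℝ) (x y a v : V) :
    Prop where
  trap : S.Trap le a x
  inner : S.Inner v
  parent_eq : S.parent v = a
  desc : S.Desc v y
  lt : φ a < φ (S.coparent v)
  escape : le (S.parent a) y ∨ le (S.coparent a) y

/-- The pairs `(x, y)` with `x ≰ y` where `y` is a leaf in the trap of `x`, but not trapped there. -/
structure InsidePair {α : Type*} [LinearOrder α] (S : RootedTwoTree V) (le : V → V → Prop)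
    (ψ : V → α) (φ : V → ℝ) (x y : V) : Prop where
  leaf : ∀ z, S.Desc y z → z = y
  not_le : ¬ le x y
  lt : ψ x < ψ y
  inside : ∃ a v, S.InsideData le φ x y a v

namespace InsideData

variable {φ : V → ℝ} {x y a v : V}

lemma desc_trap (h : S.InsideData le φ x y a v) : S.Desc a y :=
  (h.parent_eq ▸ desc_parent h.inner).trans h.desc

lemma escape_of_desc (hle : S.Separated le) (h : S.InsideData le φ x y a v) {d : V}
    (had : S.Desc a d) (hd : S.Desc d y) : le (S.parent d) y ∨ le (S.coparent d) y := by
  by_cases hda : d = a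
  · exact hda ▸ h.escape
  have hdi := had.inner_right h.trap.inner
  rcases h.escape with h' | h'
  · exact (hle.enter hdi (not_desc_parent h.trap.inner had) hd h').imp And.right And.right
  · exact (hle.enter hdi (not_desc_coparent h.trap.inner had) hd h').imp And.right And.right

/-- An edge separating `y` from the trap of `x`, with one end above `x` and the other one below
`y`, has the orientation of the edge at the trap. -/
lemma lt_of_split (hle : S.Separated le) (hφ : S.Between φ) (h : S.InsideData le φ x y a v)
    (hxy : ¬ le x y) {d : V} (had : S.Desc a d) (hne : d ≠ a) (hd : S.Desc d y) :
    (le x (S.parent d) → le (S.coparent d) y → φ (S.parent d) < φ (S.coparent d)) ∧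
    (le x (S.coparent d) → le (S.parent d) y → φ (S.coparent d) < φ (S.parent d)) := by
  induction had with
  | refl => exact absurd rfl hne
  | @tail u d hau hud ih =>
    obtain ⟨hdi, rfl⟩ := hud
    have hud := desc_parent hdi
    -- Induction down the path from the trap; at its child the orientation is the one prescribed by
    -- `InsideData.lt`.
    by_cases hua : S.parent d = a
    · obtain rfl : v = d := child_unique h.inner hdi h.parent_eq hua h.desc hd
      refine ⟨fun _ _ => hua ▸ h.lt, fun _ h2 => ?_⟩
      exact absurd (hle.trans (h.trap.le hle) (hua ▸ h2)) hxy
    have hui : S.Inner (S.parent d) := Desc.inner_right hau h.trap.inner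
    have huy := hud.trans hd
    obtain ⟨ih1, ih2⟩ := ih hua huy
    have hesc := h.escape_of_desc hle hau huy
    -- The split moves one level up: `x` must be below an end of the edge of `parent d`, and not
    -- below the end `b`, which is below `y`. `Between` then carries the orientation of that edge
    -- back down to the edge of `d`.
    have key : ∀ {b c : V}, le x (S.parent d) → le b y →
        (S.parent (S.parent d) = c ∧ S.coparent (S.parent d) = b ∨
          S.parent (S.parent d) = b ∧ S.coparent (S.parent d) = c) → le x c := by
      intro b c h1 h2 hbc
      have h3 := h.trap.le_parents hle hau hua (Desc.refl _) h1
      rcases hbc with ⟨rfl, rfl⟩ | ⟨rfl, rfl⟩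
      · exact h3.resolve_right fun h4 => hxy (hle.trans h4 h2)
      · exact h3.resolve_left fun h4 => hxy (hle.trans h4 h2)
    rcases coparent_of_inner_parent hdi hui with hq | hq
    · rw [hq]
      constructor
      · intro h1 h2
        have h3 := ih2 (key h1 h2 (Or.inr ⟨rfl, rfl⟩)) h2
        rcases hφ _ hui with h4 | h4 <;> linarith
      · intro h1 h2
        have h3 := hesc.resolve_left fun h4 => hxy (hle.trans h1 h4)
        have h5 := ih1 h1 h3
        rcases hφ _ hui with h4 | h4 <;> linarith
    · rw [hq]
      constructor
      · intro h1 h2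
        have h3 := ih1 (key h1 h2 (Or.inl ⟨rfl, rfl⟩)) h2
        rcases hφ _ hui with h4 | h4 <;> linarith
      · intro h1 h2
        have h3 := hesc.resolve_right fun h4 => hxy (hle.trans h1 h4)
        have h5 := ih2 h1 h3
        rcases hφ _ hui with h4 | h4 <;> linarith

end InsideData

end RootedTwoTree

/-! ### No alternating cycles of inside pairs -/

namespace RootedTwoTree

variable {V : Type*} {S : RootedTwoTree V} {le : V → V → Prop}

/-- `s` and `t` are the ends of the edge that `d` is attached to. -/
def Base (S : RootedTwoTree V) (d s t : V) : Prop :=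
  (S.parent d = s ∧ S.coparent d = t) ∨ (S.parent d = t ∧ S.coparent d = s)

lemma Base.symm {d s t : V} (h : S.Base d s t) : S.Base d t s := Or.symm h

lemma base_of_child {u w : V} (hw : S.Inner w) (hu : S.Inner u) (h : S.parent w = u) :
    ∃ t, S.Base u (S.coparent w) t := by
  subst h
  rcases coparent_of_inner_parent hw hu with h | h
  · exact ⟨_, Or.inl ⟨h.symm, rfl⟩⟩
  · exact ⟨_, Or.inr ⟨rfl, h.symm⟩⟩

lemma Between.of_base {φ : V → ℝ} (hφ : S.Between φ) {d s t : V} (hd : S.Inner d)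
    (h : S.Base d s t) (hst : φ s < φ t) : φ s < φ d ∧ φ d < φ t := by
  rcases h with ⟨rfl, rfl⟩ | ⟨rfl, rfl⟩ <;> rcases hφ d hd with h | h <;>
    first | exact h | exact absurd (h.1.trans h.2) (not_lt.2 hst.le)

lemma InsideData.lt_of_base (hle : S.Separated le) {φ : V → ℝ} (hφ : S.Between φ)
    {x y a v : V} (h : S.InsideData le φ x y a v) (hxy : ¬ le x y) {d s t : V}
    (had : S.Desc a d) (hne : d ≠ a) (hd : S.Desc d y) (hb : S.Base d s t) (hs : le x s)
    (ht : le t y) : φ s < φ t := by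
  have := h.lt_of_split hle hφ hxy had hne hd
  rcases hb with ⟨rfl, rfl⟩ | ⟨rfl, rfl⟩
  · exact this.1 hs ht
  · exact this.2 hs ht

lemma Base.or {A : V → Prop} {d s t : V} (hb : S.Base d s t)
    (h : A (S.parent d) ∨ A (S.coparent d)) : A s ∨ A t := by
  rcases hb with ⟨rfl, rfl⟩ | ⟨rfl, rfl⟩
  · exact h
  · exact h.symm

lemma ne_parent {v : V} (hv : S.Inner v) : v ≠ S.parent v := fun h => by
  have := S.index_parent_lt v hv.1 hv.2
  rw [← h] at this
  omega

section Cycle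

variable {α : Type*} [LinearOrder α] {ψ : V → α} {φ : V → ℝ} {n : ℕ} {x y : ℕ → V}

/-- The trap of smallest index has all `y i` below it: if it has `y i`, it lies above the trap of `x
i`, which contains `y (i + 1)`. So common ancestors exist, and `u` is the deepest. It is no `y i`,
since a leaf `y i = u` would force `y (i + 1) = y i`. -/
lemma exists_meet (hle : S.Separated le)
    (h : AlternatingCycle le (S.InsidePair le ψ φ) n x y) :
    ∃ u, S.Inner u ∧ (∀ i, S.Desc u (y i)) ∧ (∀ i, y i ≠ u) ∧
      ∀ w, (∀ i, S.Desc w (y i)) → S.Inner w → S.index w ≤ S.index u := by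
  classical
  choose a v hav using fun i => (h.mem i).inside
  obtain ⟨k, hk⟩ : ∃ k, ∀ i, S.index (a k) ≤ S.index (a i) :=
    ⟨Function.argmin (fun i => S.index (a i)),
      fun i => Function.argmin_le (fun i => S.index (a i)) i⟩
  have hak : ∀ i, S.Desc (a k) (y i) := by
    refine h.forall_right (k := k) (hav k).desc_trap fun i _ hi => ?_
    exact (hi.of_index_le (hav i).desc_trap (hk i)).trans
      ((hav i).trap.desc_of_le hle (h.le_succ i))
  let A : ℕ → Prop := fun m => ∃ u, S.index u = m ∧ S.Inner u ∧ ∀ i, S.Desc u (y i)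
  obtain ⟨u, hu, hui, huy⟩ :=
    Nat.findGreatest_spec (P := A) (hak 0).index_le ⟨a k, rfl, (hav k).trap.inner, hak⟩
  refine ⟨u, hui, huy, fun i hi => ?_, fun w hw hwi => ?_⟩
  · have h1 := (h.mem i).leaf _ (hi ▸ huy (i + 1))
    exact (h.mem i).not_le (h1 ▸ h.le_succ i)
  · rw [hu]
    exact Nat.le_findGreatest (hw 0).index_le ⟨w, rfl, hwi, hw⟩

/-- Otherwise start in the branch of the `y k` with least `ψ`. Leaving it would mean that `x i` is
in the new branch, so by convexity `ψ (y (i + 1)) < ψ (y i)`; but then `y (i + 1)` is between `y k`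
and `y i` and has not left. All `y i` would share a branch, against the depth of `u`. -/
lemma exists_jump (hψ : S.ConvexSubtrees ψ) (hinj : Function.Injective ψ)
    (h : AlternatingCycle le (S.InsidePair le ψ φ) n x y) {u : V}
    (huy : ∀ i, S.Desc u (y i)) (hne : ∀ i, y i ≠ u)
    (hu : ∀ w, (∀ i, S.Desc w (y i)) → S.Inner w → S.index w ≤ S.index u) :
    ∃ i c d, (S.Inner c ∧ S.parent c = u ∧ S.Desc c (y i)) ∧
      (S.Inner d ∧ S.parent d = u ∧ S.Desc d (y (i + 1))) ∧ c ≠ d ∧ ¬ S.Desc d (x i) := by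
  by_contra! hcon
  choose c hci hcu hcy using fun i => (huy i).exists_child (hne i)
  obtain ⟨k, hk⟩ := h.exists_min ψ
  have hall : ∀ i, S.Desc (c k) (y i) := by
    refine h.forall_right (k := k) (hcy k) fun i _ hi => ?_
    have hik : c i = c k := child_unique (hci i) (hci k) (hcu i) (hcu k) (hcy i) hi
    by_cases hc : c k = c (i + 1)
    · exact hc ▸ hcy (i + 1)
    have hx := hcon i (c k) (c (i + 1)) ⟨hci k, hcu k, hi⟩
      ⟨hci _, hcu _, hcy _⟩ hc
    have hyi : ¬ S.Desc (c (i + 1)) (y i) := fun hd =>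
      hc (child_unique (hci k) (hci _) (hcu k) (hcu _) hi hd)
    have hlt : ψ (y (i + 1)) < ψ (y i) := by
      rcases lt_trichotomy (ψ (y (i + 1))) (ψ (y i)) with hlt | heq | hlt
      · exact hlt
      · exact absurd (hinj heq ▸ hcy (i + 1)) hyi
      · exact absurd (hψ _ _ _ _ (hci _) hx (hcy (i + 1)) (h.mem i).lt hlt) hyi
    rcases (hk (i + 1)).lt_or_eq with hlt' | heq
    · exact hψ _ _ _ _ (hci k) (hcy k) hi hlt' hlt
    · exact hinj heq ▸ hcy k
  have h1 := hu _ hall (hci k)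
  have h2 := S.index_parent_lt _ (hci k).1 (hci k).2
  rw [hcu k] at h2
  omega

/-- The trap of `x` is above `u` if the successor of `y` is in another subtree at `u`. -/
lemma desc_of_jump (hle : S.Separated le) {u w x y y' a v : V} (h : S.InsideData le φ x y a v)
    (hxy' : le x y') (huy : S.Desc u y) (hw : S.Inner w) (hwu : S.parent w = u)
    (hjump : ¬ (S.Desc w y ↔ S.Desc w y')) : S.Desc a u := by
  rcases h.desc_trap.total huy with h1 | h1
  · exact h1
  by_cases hau : a = u
  · exact hau ▸ Desc.refl _
  obtain ⟨w', hw', hwu', hwa⟩ := h1.exists_child hau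
  have h2 := hwa.trans h.desc_trap
  have h3 := hwa.trans (h.trap.desc_of_le hle hxy')
  refine absurd ⟨fun h4 => ?_, fun h4 => ?_⟩ hjump
  · exact child_unique hw' hw hwu' hwu h2 h4 ▸ h3
  · exact child_unique hw' hw hwu' hwu h3 h4 ▸ h2

variable {u c d : V}

/-- Jumps whose comparability passes through the meet `u`. -/
lemma false_of_jump_through_meet (hle : S.Separated le) (hφ : S.Between φ)
    (h : AlternatingCycle le (S.InsidePair le ψ φ) n x y)
    (hstrict : ∀ j, 1 ≤ j → j < n → ¬ le (x j) (y 1)) (hui : S.Inner u)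
    (huy : ∀ i, S.Desc u (y i)) (hc : S.Inner c) (hcu : S.parent c = u) (hcy : S.Desc c (y 0))
    (hcy' : ¬ S.Desc c (y 1)) (hxu : le (x 0) u) (huy' : le u (y 1)) : False := by
  obtain ⟨a, v, h0⟩ := (h.mem 0).inside
  have hau : S.Desc a u := desc_of_jump hle h0 (h.le_succ 0) (huy 0) hc hcu (by tauto)
  have hcne : c ≠ u := hcu ▸ ne_parent hc
  have huc : S.Desc u c := hcu ▸ desc_parent hc
  have hac : c ≠ a := fun hca => hcne (Desc.antisymm (hca ▸ hau) huc)
  have hbc : S.Base c u (S.coparent c) := Or.inl ⟨hcu, rfl⟩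
  have hby : le (S.coparent c) (y 0) :=
    (hbc.or (A := fun z => le z (y 0)) (h0.escape_of_desc hle (hau.trans huc) hcy)).resolve_left
      fun h1 => (h.mem 0).not_le (hle.trans hxu h1)
  have hφ1 : φ u < φ (S.coparent c) :=
    h0.lt_of_base hle hφ (h.mem 0).not_le (hau.trans huc) hac hcy hbc hxu hby
  obtain ⟨t, ht⟩ := base_of_child hc hui hcu
  -- The edge of `u` is `{coparent c, t}`, and `φ u` lies between its ends.
  have hφ2 : φ t < φ (S.coparent c) := by
    by_contra! hcon
    rcases hcon.lt_or_eq with h1 | h1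
    · linarith [(hφ.of_base hui ht h1).1]
    · rcases ht with ⟨h2, h3⟩ | ⟨h2, h3⟩ <;> rcases hφ u hui with h4 | h4 <;>
        rw [h2, h3] at h4 <;> linarith
  -- The branch `c` is never entered again: entering needs `x j` below `u`, a shortcut to `y 1`, or
  -- below `coparent c`, which the orientations place below `y j`. Going backwards from `y n = y 0`,
  -- all of the cycle stays in `c`.
  have hstep : ∀ j, 1 ≤ j → j < n → S.Desc c (y (j + 1)) → S.Desc c (y j) := by
    intro j hj hjn hcj
    by_contra hcon
    obtain ⟨a', v', hj'⟩ := (h.mem j).inside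
    have hau' : S.Desc a' u :=
      desc_of_jump hle hj' (h.le_succ j) (huy j) hc hcu (by tauto)
    have hxju : ¬ le (x j) u := fun h1 => hstrict j hj hjn (hle.trans h1 huy')
    have hne : u ≠ a' := fun h1 => hxju (h1 ▸ hj'.trap.le hle)
    have hx := ht.or (A := fun z => le (x j) z)
      (hj'.trap.le_parents hle hau' hne (huy (j + 1)) (h.le_succ j))
    have hy := ht.or (A := fun z => le z (y j)) (hj'.escape_of_desc hle hau' (huy j))
    have hby' : le (S.coparent c) (y j) := by
      refine hy.resolve_right fun h1 => ?_
      have h2 := hx.resolve_right fun h2 => (h.mem j).not_le (hle.trans h2 h1)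
      have := hj'.lt_of_base hle hφ (h.mem j).not_le hau' hne (huy j) ht h2 h1
      linarith
    have hac' : c ≠ a' := fun hca => hcne (Desc.antisymm (hca ▸ hau') huc)
    rcases hbc.or (A := fun z => le (x j) z)
      (hj'.trap.le_parents hle (hau'.trans huc) hac' hcj (h.le_succ j)) with h1 | h1
    · exact hxju h1
    · exact (h.mem j).not_le (hle.trans h1 hby')
  have hall : ∀ k, k < n → S.Desc c (y (n - k)) := by
    intro k
    induction k with
    | zero => intro _; rw [Nat.sub_zero, show n = 0 + n by ring, h.right_periodic]; exact hcy
    | succ k ih =>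
      intro hk
      refine hstep _ (by omega) (by omega) ?_
      rw [show n - (k + 1) + 1 = n - k by omega]
      exact ih (by omega)
  have hpos := h.pos
  refine hcy' ?_
  have := hall (n - 1) (by omega)
  rwa [show n - (n - 1) = 1 by omega] at this

/-- Jumps whose comparability passes through the other end of the edge that is entered. -/
lemma false_of_jump_through_coparent (hle : S.Separated le) (hφ : S.Between φ)
    (h : AlternatingCycle le (S.InsidePair le ψ φ) n x y)
    (hstrict : ∀ j, 1 ≤ j → j < n → ¬ le (x j) (y 1)) (hui : S.Inner u)
    (huy : ∀ i, S.Desc u (y i)) (hd : S.Inner d) (hdu : S.parent d = u) (hdy : S.Desc d (y 1))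
    (hdy' : ¬ S.Desc d (y 0)) (hxb : le (x 0) (S.coparent d)) (hby : le (S.coparent d) (y 1)) :
    False := by
  obtain ⟨a, v, h0⟩ := (h.mem 0).inside
  have hau : S.Desc a u := desc_of_jump hle h0 (h.le_succ 0) (huy 0) hd hdu (by tauto)
  have hdne : d ≠ u := hdu ▸ ne_parent hd
  have hud : S.Desc u d := hdu ▸ desc_parent hd
  have hbd : S.Base d u (S.coparent d) := Or.inl ⟨hdu, rfl⟩
  obtain ⟨t, ht⟩ := base_of_child hd hui hdu
  have hne : u ≠ a := by
    rintro rfl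
    rcases ht with ⟨h1, -⟩ | ⟨-, h1⟩
    · exact h0.trap.not_parent (h1 ▸ hxb)
    · exact h0.trap.not_coparent (h1 ▸ hxb)
  have hty : le t (y 0) :=
    (ht.or (A := fun z => le z (y 0)) (h0.escape_of_desc hle hau (huy 0))).resolve_left
      fun h1 => (h.mem 0).not_le (hle.trans hxb h1)
  have hφ1 : φ (S.coparent d) < φ t :=
    h0.lt_of_base hle hφ (h.mem 0).not_le hau hne (huy 0) ht hxb hty
  have hφ2 := (hφ.of_base hui ht hφ1).1
  -- The branch `d` is never left again: leaving would put `coparent d` below `y j` and `x j` below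
  -- `u` or `t`, which reverses one of the two orientations found at the jump. So `y n = y 0` would
  -- be in `d`.
  have hstep : ∀ j, 1 ≤ j → j < n → S.Desc d (y j) → S.Desc d (y (j + 1)) := by
    intro j hj hjn hdj
    by_contra hcon
    obtain ⟨a', v', hj'⟩ := (h.mem j).inside
    have hau' : S.Desc a' u :=
      desc_of_jump hle hj' (h.le_succ j) (huy j) hd hdu (by tauto)
    have hxjb : ¬ le (x j) (S.coparent d) := fun h1 => hstrict j hj hjn (hle.trans h1 hby)
    by_cases hne : u = a'
    · have hxu : le (x j) u := hne ▸ hj'.trap.le hle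
      have hbj := (hbd.or (A := fun z => le z (y j))
        (hj'.escape_of_desc hle (hau'.trans hud) hdj)).resolve_left
          fun h1 => (h.mem j).not_le (hle.trans hxu h1)
      have := hj'.lt_of_base hle hφ (h.mem j).not_le (hau'.trans hud) (hne ▸ hdne) hdj hbd hxu hbj
      linarith
    · have hxt := (ht.or (A := fun z => le (x j) z)
        (hj'.trap.le_parents hle hau' hne (huy (j + 1)) (h.le_succ j))).resolve_left hxjb
      have hbj := (ht.or (A := fun z => le z (y j))
        (hj'.escape_of_desc hle hau' (huy j))).resolve_right
          fun h1 => (h.mem j).not_le (hle.trans hxt h1)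
      have := hj'.lt_of_base hle hφ (h.mem j).not_le hau' hne (huy j) ht.symm hxt hbj
      linarith
  have hall : ∀ k, k < n → S.Desc d (y (k + 1)) := by
    intro k
    induction k with
    | zero => intro _; exact hdy
    | succ k ih => intro hk; exact hstep _ (by omega) (by omega) (ih (by omega))
  have hpos := h.pos
  refine hdy' ?_
  have := hall (n - 1) (by omega)
  rwa [show n - 1 + 1 = 0 + n by omega, h.right_periodic] at this

lemma not_alternatingCycle_insidePair (hle : S.Separated le) (hψ : S.ConvexSubtrees ψ)
    (hinj : Function.Injective ψ) (hφ : S.Between φ) (n : ℕ) (x y : ℕ → V) :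
    ¬ AlternatingCycle le (S.InsidePair le ψ φ) n x y := by
  intro h
  obtain ⟨n, x, y, h, hmin⟩ := h.exists_minimal
  obtain ⟨u, hui, huy, hne, hu⟩ := exists_meet hle h
  obtain ⟨i, c, d, ⟨hc, hcu, hcy⟩, ⟨hd, hdu, hdy⟩, hcd, hdx⟩ := exists_jump hψ hinj h huy hne hu
  have h' := h.shift i
  have hstrict : ∀ j, 1 ≤ j → j < n → ¬ le (x (j + i)) (y (1 + i)) := fun j hj hjn hj' =>
    absurd (hmin _ _ _ (h'.of_shortcut hj hj')) (not_le.2 hjn)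
  have hcy' : ¬ S.Desc c (y (1 + i)) := fun h1 =>
    hcd (child_unique hc hd hcu hdu h1 (add_comm i 1 ▸ hdy))
  have hdy' : ¬ S.Desc d (y (0 + i)) := fun h1 =>
    hcd (child_unique hc hd hcu hdu hcy (zero_add i ▸ h1))
  rw [add_comm] at hdy
  -- The cycle is rotated so that the jump starts at index 0; it enters the subtree of `d` through
  -- one of the ends of its edge.
  have hl := h'.le_succ 0
  simp only [zero_add] at hl
  rcases hle.enter hd hdx hdy hl with ⟨h1, h2⟩ | ⟨h1, h2⟩
  · exact false_of_jump_through_meet hle hφ h' hstrict hui (fun _ => huy _) hc hcu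
      (by simpa using hcy) hcy' (by simpa [hdu] using h1) (hdu ▸ h2)
  · exact false_of_jump_through_coparent hle hφ h' hstrict hui (fun _ => huy _) hd hdu
      hdy hdy' (by simpa using h1) h2

end Cycle

end RootedTwoTree

/-! ### From alternating cycles to linear extensions -/

section Reversible

lemma Relation.TransGen.exists_sequence {β : Type*} {R : β → β → Prop} {p q : β}
    (h : Relation.TransGen R p q) :
    ∃ (n : ℕ) (f : ℕ → β), 0 < n ∧ f 0 = p ∧ f n = q ∧ ∀ i < n, R (f i) (f (i + 1)) := by
  classical
  induction h with
  | @single q h =>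
    refine ⟨1, fun i => if i = 0 then p else q, one_pos, rfl, rfl, fun i hi => ?_⟩
    obtain rfl : i = 0 := by omega
    simpa using h
  | @tail q q' _ h ih =>
    obtain ⟨n, f, hn, h0, h1, hf⟩ := ih
    refine ⟨n + 1, fun i => if i ≤ n then f i else q', by omega, by simpa using h0, by simp,
      fun i hi => ?_⟩
    rcases (Nat.lt_succ_iff.1 hi).lt_or_eq with hi | rfl
    · simpa [hi.le, Nat.succ_le_of_lt hi] using hf i hi
    · simpa [h1] using h

/-- A set of pairs without alternating cycles is reversed by a linear extension. -/
lemma exists_linearOrder_reversing {P : Type*} [PartialOrder P] {C : P → P → Prop}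
    (hC : ∀ n x y, ¬ AlternatingCycle (· ≤ ·) C n x y) :
    ∃ L : LinearOrder P, (∀ a b, a ≤ b → L.le a b) ∧ ∀ a b, C a b → ¬ L.le a b := by
  classical
  -- Closed walks of `T` are exactly alternating cycles.
  let T : {p : P × P // C p.1 p.2} → {p : P × P // C p.1 p.2} → Prop := fun p p' => p.1.1 ≤ p'.1.2
  have hT : ∀ p, ¬ Relation.TransGen T p p := by
    intro p hp
    obtain ⟨n, f, hn, h0, h1, hf⟩ := hp.exists_sequence
    refine hC n (fun i => (f (i % n)).1.1) (fun i => (f (i % n)).1.2)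
      ⟨hn, fun i => by simp, fun i => by simp, fun i => (f (i % n)).2, fun i => ?_⟩
    have h2 := hf (i % n) (Nat.mod_lt _ hn)
    rw [← Nat.mod_add_mod]
    rcases (Nat.succ_le_of_lt (Nat.mod_lt i hn)).lt_or_eq with h3 | h3
    · rw [Nat.mod_eq_of_lt h3]
      exact h2
    · rw [show i % n + 1 = n from h3, h1] at h2
      rw [show i % n + 1 = n from h3, Nat.mod_self, h0]
      exact h2
  -- The transitive closure of the order with all pairs of `C` reversed; a failure of antisymmetry
  -- would close up a walk of `T`.
  let r : P → P → Prop := fun a b => a ≤ b ∨ ∃ p p', a ≤ p.1.2 ∧ Relation.ReflTransGen T p p' ∧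
    p'.1.1 ≤ b
  have hr : IsPartialOrder P r :=
    { refl := fun a => Or.inl le_rfl
      trans := by
        rintro a b c (h1 | ⟨p, p', h1, h2, h3⟩) (h4 | ⟨q, q', h4, h5, h6⟩)
        · exact Or.inl (h1.trans h4)
        · exact Or.inr ⟨q, q', h1.trans h4, h5, h6⟩
        · exact Or.inr ⟨p, p', h1, h2, h3.trans h4⟩
        · exact Or.inr ⟨p, q', h1, h2.trans (h5.head (show T p' q from h3.trans h4)), h6⟩
      antisymm := by
        rintro a b (h1 | ⟨p, p', h1, h2, h3⟩) (h4 | ⟨q, q', h4, h5, h6⟩)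
        · exact le_antisymm h1 h4
        · exact absurd (Relation.TransGen.tail' h5 (show T q' q from (h6.trans h1).trans h4)) (hT q)
        · exact absurd (Relation.TransGen.tail' h2 (show T p' p from (h3.trans h4).trans h1)) (hT p)
        · exact absurd (Relation.TransGen.tail'
            (h2.trans (h5.head (show T p' q from h3.trans h4))) (show T q' p from h6.trans h1))
            (hT p) }
  obtain ⟨s, hs, hrs⟩ := extend_partialOrder r
  let L : LinearOrder P :=
    { le := s
      lt := fun a b => s a b ∧ ¬ s b a
      lt_iff_le_not_ge := fun _ _ => Iff.rfl
      le_refl := hs.refl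
      le_trans := hs.trans
      le_antisymm := hs.antisymm
      le_total := hs.total
      toDecidableLE := Classical.decRel _ }
  refine ⟨L, fun a b h => hrs a b (Or.inl h), fun a b hab hsab => ?_⟩
  have h1 : s b a := hrs b a (Or.inr ⟨⟨(a, b), hab⟩, ⟨(a, b), hab⟩, le_rfl, .refl, le_rfl⟩)
  obtain rfl : a = b := hs.antisymm _ _ hsab h1
  exact hT ⟨(a, a), hab⟩ (.single (show T _ _ from le_rfl (a := a)))

/-- Read the cycle backwards with both sides exchanged. The index is `-i` modulo `n`, with multiples
of `n` added so that the subtraction is not truncated. -/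
lemma AlternatingCycle.reverse {V : Type*} {le C : V → V → Prop} {n : ℕ} {x y : ℕ → V}
    (h : AlternatingCycle le C n x y) :
    AlternatingCycle (fun a b => le b a) (fun a b => C b a) n
      (fun i => y (n * i + n - i)) (fun i => x (n * i + n - i)) := by
  have hx : ∀ i k, x (i + k * n) = x i := by
    intro i k
    induction k with
    | zero => simp
    | succ k ih => rw [show i + (k + 1) * n = i + k * n + n by ring, h.left_periodic, ih]
  have hn := h.pos
  have hle : ∀ i, i ≤ n * i := fun i => Nat.le_mul_of_pos_left i hn
  have key : ∀ i, n * (i + n) + n - (i + n) = n * i + n - i + (n - 1) * n := by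
    intro i
    have h1 := hle i
    obtain ⟨m, rfl⟩ : ∃ m, n = m + 1 := ⟨n - 1, by omega⟩
    have h2 : (m + 1) * (i + (m + 1)) = (m + 1) * i + m * (m + 1) + (m + 1) := by ring
    simp only [h2, Nat.add_sub_cancel]
    omega
  refine ⟨hn, fun i => ?_, fun i => ?_, fun i => h.mem _, fun i => ?_⟩
  · simp only [key, h.right_periodic_mul]
  · simp only [key, hx]
  · have h1 := h.le_succ (n * (i + 1) + n - (i + 1))
    have h2 := hle i
    have h3 : n * (i + 1) + n - (i + 1) + 1 = n * i + n - i + n := by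
      rw [Nat.mul_succ]
      omega
    rw [h3, h.right_periodic] at h1
    exact h1

lemma posetDimension_le_of_reversible {P : Type*} [PartialOrder P] {d : ℕ}
    (C : Fin d → P → P → Prop) (hC : ∀ k n x y, ¬ AlternatingCycle (· ≤ ·) (C k) n x y)
    (hcover : ∀ a b : P, ¬ a ≤ b → ∃ k, C k a b) : posetDimension P ≤ d := by
  choose L hL hL' using fun k => exists_linearOrder_reversing (hC k)
  refine iInf₂_le d ⟨L, fun a b => ⟨fun h k => hL k a b h, fun h => ?_⟩⟩
  by_contra hab
  obtain ⟨k, hk⟩ := hcover a b hab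
  exact hL' k a b hk (h k)

end Reversible

/-! ### The labellings `φ` and `ψ` -/

lemma List.prefix_of_lt_of_lt {l a b c : List ℕ} (ha : l <+: a) (hc : l <+: c) (hab : a < b)
    (hbc : b < c) : l <+: b := by
  induction l generalizing a b c with
  | nil => exact List.nil_prefix
  | cons k l ih =>
    obtain ⟨a, rfl⟩ := ha
    obtain ⟨c, rfl⟩ := hc
    cases b with
    | nil => exact absurd hab (List.not_lt_nil _)
    | cons m b =>
      rw [List.cons_append, List.cons_lt_cons_iff] at hab hbc
      have hkm : k = m := by omega
      subst hkm
      rw [List.cons_prefix_cons]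
      exact ⟨rfl, ih (List.prefix_append l a) (List.prefix_append l c)
        (by simpa using hab) (by simpa using hbc)⟩

namespace RootedTwoTree

variable {V : Type*} {S : RootedTwoTree V} {le : V → V → Prop}

open Classical in
/-- Labels of the vertices, defined from those of the ends of the edge that a vertex is attached
to. -/
noncomputable def label {β : Type*} (S : RootedTwoTree V) (b b' : β) (F : V → β → β → β) (v : V) :
    β :=
  if _h : v = S.first then b
  else if _h' : v = S.second then b'
  else F v (label S b b' F (S.parent v)) (label S b b' F (S.coparent v))
termination_by S.index v
decreasing_by
  · exact S.index_parent_lt v _h _h'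
  · exact S.index_coparent_lt v _h _h'

section Label

variable {β : Type*} {b b' : β} {F : V → β → β → β}

lemma label_first : S.label b b' F S.first = b := by
  rw [label]
  simp

lemma label_second : S.label b b' F S.second = b' := by
  rw [label]
  simp [S.first_ne_second.symm]

lemma label_inner {v : V} (hv : S.Inner v) :
    S.label b b' F v = F v (S.label b b' F (S.parent v)) (S.label b b' F (S.coparent v)) := by
  rw [label]
  simp [hv.1, hv.2]

end Label

lemma exists_between (S : RootedTwoTree V) : ∃ φ : V → ℝ, S.Between φ := by
  let φ := S.label (0 : ℝ) 1 fun _ s t => (s + t) / 2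
  have hφ : ∀ v, S.Inner v → φ v = (φ (S.parent v) + φ (S.coparent v)) / 2 :=
    fun v hv => label_inner hv
  -- Midpoints lie strictly between the ends only if the ends differ; new edges join a midpoint to
  -- an end, so this is inherited.
  have hne : ∀ n v, S.index v = n → S.Inner v → φ (S.parent v) ≠ φ (S.coparent v) := by
    intro n
    induction n using Nat.strong_induction_on with
    | _ n ih =>
      rintro v rfl hv heq
      rcases S.parent_cases v hv.1 hv.2 with ⟨h1, h2⟩ | ⟨hp, h⟩
      · rw [h1, h2] at heq
        have h3 : φ S.first = 0 := label_first
        have h4 : φ S.second = 1 := label_second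
        rw [h3, h4] at heq
        exact one_ne_zero heq
      · have h1 := ih _ (S.index_parent_lt v hv.1 hv.2) _ rfl hp
        have h2 := hφ _ hp
        rcases h with h | h <;> rw [h] at heq <;> exact h1 (by linarith)
  refine ⟨φ, fun v hv => ?_⟩
  have h1 := hφ v hv
  rcases lt_or_gt_of_ne (hne _ v rfl hv) with h | h
  · exact Or.inl ⟨by linarith, by linarith⟩
  · exact Or.inr ⟨by linarith, by linarith⟩

lemma Between.neg {φ : V → ℝ} (h : S.Between φ) : S.Between (fun v => -φ v) := fun v hv => by
  rcases h v hv with h | h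
  · exact Or.inr ⟨neg_lt_neg h.2, neg_lt_neg h.1⟩
  · exact Or.inl ⟨neg_lt_neg h.2, neg_lt_neg h.1⟩

/-- Label a vertex by the list of indices on its path from the top. Descendants are then the
extensions of a list, and these form an interval in the lexicographic order. -/
lemma exists_convexSubtrees (S : RootedTwoTree V) :
    ∃ ψ : V → List ℕ, Function.Injective ψ ∧ S.ConvexSubtrees ψ := by
  let ψ := S.label [S.index S.first] [S.index S.second] fun v s _ => s ++ [S.index v]
  have h1 : ψ S.first = [S.index S.first] := label_first
  have h2 : ψ S.second = [S.index S.second] := label_second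
  have h3 : ∀ v, S.Inner v → ψ v = ψ (S.parent v) ++ [S.index v] := fun v hv => label_inner hv
  have hlast : ∀ v, ∃ l, ψ v = l ++ [S.index v] := by
    intro v
    by_cases hv : v = S.first
    · exact ⟨[], by rw [hv, h1]; rfl⟩
    by_cases hv' : v = S.second
    · exact ⟨[], by rw [hv', h2]; rfl⟩
    exact ⟨_, h3 v ⟨hv, hv'⟩⟩
  have hinj : Function.Injective ψ := by
    intro u v huv
    obtain ⟨l, hl⟩ := hlast u
    obtain ⟨l', hl'⟩ := hlast v
    rw [hl, hl'] at huv
    exact S.index_injective (by simpa using (List.append_inj' huv rfl).2)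
  have hprefix : ∀ u v, S.Desc u v → ψ u <+: ψ v := by
    intro u v h
    induction h with
    | refl => exact List.prefix_rfl
    | tail _ h ih =>
      obtain ⟨h, rfl⟩ := h
      rw [h3 _ h]
      exact ih.trans (List.prefix_append _ _)
  have hdesc : ∀ n u v, S.index v = n → S.Inner u → ψ u <+: ψ v → S.Desc u v := by
    intro n
    induction n using Nat.strong_induction_on with
    | _ n ih =>
      rintro u v rfl hu huv
      by_cases hv : S.Inner v
      · rw [h3 v hv, List.prefix_concat_iff, ← h3 v hv] at huv
        rcases huv with h | h
        · exact hinj h ▸ Desc.refl u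
        · exact (ih _ (S.index_parent_lt v hv.1 hv.2) _ _ rfl hu h).trans (desc_parent hv)
      · have h4 : ψ v = [S.index v] := by
          by_cases hv1 : v = S.first
          · rw [hv1, h1]
          · have : v = S.second := by
              by_contra hv2
              exact hv ⟨hv1, hv2⟩
            rw [this, h2]
        obtain ⟨l, hl⟩ := hlast u
        rw [h4, hl] at huv
        have h5 := huv.length_le
        have h6 : l = [] := List.eq_nil_of_length_eq_zero (by simpa using h5)
        subst h6
        rw [List.nil_append, List.cons_prefix_cons] at huv
        exact S.index_injective huv.1 ▸ Desc.refl u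
  exact ⟨ψ, hinj, fun u a b c hu ha hc hab hbc => hdesc _ _ _ rfl hu
    (List.prefix_of_lt_of_lt (hprefix _ _ ha) (hprefix _ _ hc) hab hbc)⟩

lemma ConvexSubtrees.toDual {α : Type*} [LinearOrder α] {ψ : V → α} (h : S.ConvexSubtrees ψ) :
    S.ConvexSubtrees (fun v => OrderDual.toDual (ψ v)) :=
  fun u a b c hu ha hc hab hbc => h u c b a hu hc ha hbc hab

/-! ### The twelve sets of pairs -/

/-- Pairs where `y` is in the trap of `x` but not trapped itself there. -/
lemma insidePair_or {α : Type*} [LinearOrder α] {ψ : V → α} (hinj : Function.Injective ψ)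
    {φ : V → ℝ} (hφ : S.Between φ) {x y a : V} (hne : y ≠ x)
    (hleaf : ∀ z, S.Desc y z → z = y) (hxy : ¬ le x y) (ha : S.Trap le a x)
    (hay : S.Desc a y) (hesc : le (S.parent a) y ∨ le (S.coparent a) y) :
    (S.InsidePair le ψ φ x y ∨ S.InsidePair le ψ (fun v => -φ v) x y) ∨
      (S.InsidePair le (fun v => OrderDual.toDual (ψ v)) φ x y ∨
        S.InsidePair le (fun v => OrderDual.toDual (ψ v)) (fun v => -φ v) x y) := by
  have hya : y ≠ a := fun h => by
    subst h
    exact hne (hleaf _ ha.desc).symm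
  obtain ⟨v, hv, hva, hvy⟩ := hay.exists_child hya
  have hφne : φ a ≠ φ (S.coparent v) := by
    rw [← hva]
    rcases hφ v hv with h | h <;> [exact (h.1.trans h.2).ne; exact (h.1.trans h.2).ne']
  have hψ : ψ x ≠ ψ y := fun h => hne (hinj h).symm
  rcases lt_or_gt_of_ne hψ with h1 | h1 <;> rcases lt_or_gt_of_ne hφne with h2 | h2
  · exact Or.inl (Or.inl ⟨hleaf, hxy, h1, a, v, ha, hv, hva, hvy, h2, hesc⟩)
  · exact Or.inl (Or.inr ⟨hleaf, hxy, h1, a, v, ha, hv, hva, hvy, neg_lt_neg h2, hesc⟩)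
  · exact Or.inr (Or.inl ⟨hleaf, hxy, h1, a, v, ha, hv, hva, hvy, h2, hesc⟩)
  · exact Or.inr (Or.inr ⟨hleaf, hxy, h1, a, v, ha, hv, hva, hvy, neg_lt_neg h2, hesc⟩)

lemma outsidePair_or {α : Type*} [LinearOrder α] {ψ : V → α} (hinj : Function.Injective ψ)
    {x y a : V} (ha : S.Trap le a x) (hay : ¬ S.Desc a y) :
    S.OutsidePair le ψ x y ∨ S.OutsidePair le (fun v => OrderDual.toDual (ψ v)) x y := by
  have hψ : ψ x ≠ ψ y := fun h => hay (hinj h ▸ ha.desc)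
  rcases lt_or_gt_of_ne hψ with h | h
  · exact Or.inl ⟨h, a, ha, hay⟩
  · exact Or.inr ⟨h, a, ha, hay⟩

/-- The pairs with `x ≰ y` are of an outside or an inside type, for `le` or its dual. -/
lemma exists_trap_cases (hle : S.Separated le) {x y : V} (hx : S.Inner x) (hy : S.Inner y)
    (hxy : ¬ le x y) :
    (∃ a, S.Trap le a x ∧ (S.Desc a y → le (S.parent a) y ∨ le (S.coparent a) y)) ∨
    (∃ a, S.Trap (fun u v => le v u) a y ∧
      (S.Desc a x → le x (S.parent a) ∨ le x (S.coparent a))) := by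
  obtain ⟨a, ha⟩ := exists_trap hle hx
  obtain ⟨b, hb⟩ := exists_trap hle.dual hy
  by_contra! hcon
  obtain ⟨h1, h2, h3⟩ := hcon.1 a ha
  obtain ⟨h4, h5, h6⟩ := hcon.2 b hb
  have hab : a ≠ b := fun h => hxy (hle.trans (ha.le hle) (h ▸ hb.le hle.dual))
  -- Both traps have `x` in their subtrees, so they are nested; the depth of the upper one gives the
  -- escape at the lower one.
  rcases ha.desc.total h4 with h | h
  · rcases ha.deepest h hab.symm h4 with h | h
    · exact h5 h
    · exact h6 h
  · rcases hb.deepest h hab h1 with h | h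
    · exact h2 h
    · exact h3 h

theorem posetDimension_le {P : Type*} [PartialOrder P] (hle : S.Separated le) (m M : P → V)
    (hm : ∀ a, S.Inner (m a) ∧ ∀ z, S.Desc (m a) z → z = m a)
    (hM : ∀ a, S.Inner (M a) ∧ ∀ z, S.Desc (M a) z → z = M a)
    (hne : ∀ a b, M b ≠ m a) (hmM : ∀ a b, a ≤ b ↔ le (m a) (M b)) :
    posetDimension P ≤ 12 := by
  obtain ⟨φ, hφ⟩ := S.exists_between
  obtain ⟨ψ, hinj, hψ⟩ := S.exists_convexSubtrees
  let ψ' : V → (List ℕ)ᵒᵈ := fun v => OrderDual.toDual (ψ v)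
  have hinj' : Function.Injective ψ' := fun a b h => hinj (OrderDual.toDual.injective h)
  have hψ' : S.ConvexSubtrees ψ' := hψ.toDual
  let ge : V → V → Prop := fun u v => le v u
  have hge : S.Separated ge := hle.dual
  let D : Fin 6 → (V → V → Prop) → V → V → Prop := fun k r =>
    ![S.OutsidePair r ψ, S.OutsidePair r ψ',
      S.InsidePair r ψ φ, S.InsidePair r ψ (fun v => -φ v),
      S.InsidePair r ψ' φ, S.InsidePair r ψ' (fun v => -φ v)] k
  have hD : ∀ r, S.Separated r → ∀ k n x y, ¬ AlternatingCycle r (D k r) n x y := by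
    intro r hr k n x y
    fin_cases k
    · exact not_alternatingCycle_outsidePair hr hψ hinj n x y
    · exact not_alternatingCycle_outsidePair hr hψ' hinj' n x y
    · exact not_alternatingCycle_insidePair hr hψ hinj hφ n x y
    · exact not_alternatingCycle_insidePair hr hψ hinj hφ.neg n x y
    · exact not_alternatingCycle_insidePair hr hψ' hinj' hφ n x y
    · exact not_alternatingCycle_insidePair hr hψ' hinj' hφ.neg n x y
  have hcover : ∀ r, S.Separated r → ∀ x y, y ≠ x → (∀ z, S.Desc y z → z = y) → ¬ r x y →
      (∃ a, S.Trap r a x ∧ (S.Desc a y → r (S.parent a) y ∨ r (S.coparent a) y)) →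
      ∃ k, D k r x y := by
    rintro r hr x y hne hleaf hxy ⟨a, ha, hesc⟩
    by_cases hay : S.Desc a y
    · rcases insidePair_or hinj hφ hne hleaf hxy ha hay (hesc hay) with (h | h) | (h | h)
      · exact ⟨2, h⟩
      · exact ⟨3, h⟩
      · exact ⟨4, h⟩
      · exact ⟨5, h⟩
    · rcases outsidePair_or hinj ha hay with h | h
      · exact ⟨0, h⟩
      · exact ⟨1, h⟩
  refine posetDimension_le_of_reversible (d := 6 + 6) (fun k a b =>
    Fin.append (fun k => D k le (m a) (M b)) (fun k => D k ge (M b) (m a)) k) ?_ ?_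
  · intro k n x y h
    have hcyc : ∀ C : V → V → Prop, AlternatingCycle (· ≤ ·) (fun a b => C (m a) (M b)) n x y →
        AlternatingCycle le C n (fun i => m (x i)) (fun i => M (y i)) := fun C h =>
      ⟨h.pos, fun i => congrArg m (h.left_periodic i), fun i => congrArg M (h.right_periodic i),
        h.mem, fun i => (hmM _ _).1 (h.le_succ i)⟩
    induction k using Fin.addCases with
    | left k =>
      simp only [Fin.append_left] at h
      exact hD le hle k _ _ _ (hcyc _ h)
    | right k =>
      simp only [Fin.append_right] at h
      exact hD ge hge k _ _ _ (hcyc (fun u v => D k ge v u) h).reverse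
  · intro a b hab
    rw [hmM] at hab
    rcases exists_trap_cases hle (hm a).1 (hM b).1 hab with h | h
    · obtain ⟨k, hk⟩ := hcover le hle _ _ (hne a b) (hM b).2 hab h
      exact ⟨Fin.castAdd 6 k, by simpa only [Fin.append_left] using hk⟩
    · obtain ⟨k, hk⟩ := hcover ge hge _ _ (hne a b).symm (hm a).2 hab h
      exact ⟨Fin.natAdd 6 k, by simpa only [Fin.append_right] using hk⟩

end RootedTwoTree

/-! ### Elimination orders from tree-decompositions -/

namespace SimpleGraph.IsTree

variable {N : Type*} {T : SimpleGraph N}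

lemma length_eq_dist (hT : T.IsTree) {u v : N} {p : T.Walk u v} (hp : p.IsPath) :
    p.length = T.dist u v := by
  obtain ⟨q, hq, hl⟩ := hT.connected.exists_path_of_dist u v
  rw [← hl, (hT.existsUnique_path u v).unique hp hq]

lemma dist_lt_of_mem_support (hT : T.IsTree) {u v w : N} {p : T.Walk u v} (hp : p.IsPath)
    (hw : w ∈ p.support) (hne : w ≠ v) : T.dist u w < T.dist u v := by
  classical
  rw [← hT.length_eq_dist hp, ← hT.length_eq_dist (hp.takeUntil hw)]
  exact SimpleGraph.Walk.length_takeUntil_lt_length hw hne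

end SimpleGraph.IsTree

namespace TreeDecomposition

variable {V : Type*} {G : SimpleGraph V}

/-- For a node `t` containing `x` at minimum distance from the root `ρ`, the path from `ρ` to any
node containing `x` passes through `t`. -/
lemma mem_support_of_dist_min (D : TreeDecomposition G) {ρ t n : D.Node} {x : V}
    (ht : x ∈ D.bag t) (hmin : ∀ m, x ∈ D.bag m → D.tree.dist ρ t ≤ D.tree.dist ρ m)
    (hn : x ∈ D.bag n) {p : D.tree.Walk ρ n} (hp : p.IsPath) : t ∈ p.support := by
  obtain ⟨q, hq, -⟩ := D.isTree.existsUnique_path ρ t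
  obtain ⟨q', hq', -⟩ := D.isTree.existsUnique_path t n
  -- Nodes after `t` contain `x`, while nodes before `t` are too close to `ρ` to do so.
  have hqq' : (q.append q').IsPath := by
    rw [SimpleGraph.Walk.isPath_def, SimpleGraph.Walk.support_append, List.nodup_append']
    refine ⟨hq.support_nodup, hq'.support_nodup.tail, fun m hm hm' => ?_⟩
    have hmt : m ≠ t := by
      rintro rfl
      have := hq'.support_nodup
      rw [← SimpleGraph.Walk.cons_tail_support] at this
      exact (List.nodup_cons.1 this).1 hm'
    have hxm : x ∈ D.bag m :=
      D.inter_subset_bag t n m q' hq' (List.mem_of_mem_tail hm') ⟨ht, hn⟩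
    exact absurd (hmin m hxm) (not_le.2 (D.isTree.dist_lt_of_mem_support hq hm hmt))
  rw [(D.isTree.existsUnique_path ρ n).unique hp hqq', SimpleGraph.Walk.mem_support_append_iff]
  exact Or.inl q.end_mem_support

/-- A tree decomposition gives an elimination order (the reverse of the order of the values of
`r`) in which the later neighbourhoods are contained in small cliques. -/
lemma exists_elimination [Finite V] (D : TreeDecomposition G) {k : ℕ}
    (hD : ∀ u, (D.bag u).encard ≤ k + 1) :
    ∃ (r : V → ℕ) (N : V → Set V), Function.Injective r ∧ (∀ x, ∀ z ∈ N x, r z < r x) ∧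
      (∀ x y, G.Adj x y → r x < r y → x ∈ N y) ∧
      (∀ x z z', z ∈ N x → z' ∈ N x → r z < r z' → z ∈ N z') ∧ ∀ x, (N x).encard ≤ k := by
  classical
  obtain ⟨ρ⟩ : Nonempty D.Node := D.isTree.connected.nonempty
  have htop : ∀ x, ∃ t, x ∈ D.bag t ∧ ∀ m, x ∈ D.bag m → D.tree.dist ρ t ≤ D.tree.dist ρ m := by
    intro x
    have hx := D.exists_mem_bag x
    let f : {u : D.Node // x ∈ D.bag u} → ℕ := fun u => D.tree.dist ρ u
    have : Nonempty {u : D.Node // x ∈ D.bag u} := ⟨⟨hx.choose, hx.choose_spec⟩⟩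
    obtain ⟨u, hu⟩ : ∃ u, ∀ m, f u ≤ f m := ⟨Function.argmin f, fun m => Function.argmin_le f m⟩
    exact ⟨u, u.2, fun m hm => hu ⟨m, hm⟩⟩
  choose t ht hmin using htop
  -- If two vertices share a bag, both of their top nodes are on the path from `ρ` to it, so the one
  -- with the higher top is in the top bag of the other.
  have key : ∀ n z z', z ∈ D.bag n → z' ∈ D.bag n →
      D.tree.dist ρ (t z) ≤ D.tree.dist ρ (t z') → z ∈ D.bag (t z') := by
    intro n z z' hz hz' hle
    obtain ⟨p, hp, -⟩ := D.isTree.existsUnique_path ρ n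
    have h1 := D.mem_support_of_dist_min (ht z) (hmin z) hz hp
    have h2 := D.mem_support_of_dist_min (ht z') (hmin z') hz' hp
    rw [← p.take_spec h1, SimpleGraph.Walk.mem_support_append_iff] at h2
    rcases h2 with h2 | h2
    · have : t z' = t z := by
        by_contra hne
        exact absurd hle (not_le.2 (D.isTree.dist_lt_of_mem_support (hp.takeUntil h1) h2 hne))
      exact this ▸ ht z
    · exact D.inter_subset_bag _ _ _ _ (hp.dropUntil h1) h2 ⟨ht z, hz⟩
  obtain ⟨m, ⟨e⟩⟩ := Finite.exists_equiv_fin V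
  -- Sort by the depth of the top node and break ties by an enumeration, whose values are less than
  -- `m`.
  let r : V → ℕ := fun x => m * D.tree.dist ρ (t x) + e x
  have hr : ∀ x y, r x ≤ r y → D.tree.dist ρ (t x) ≤ D.tree.dist ρ (t y) := by
    intro x y h
    by_contra! hlt
    have h1 := (e y).2
    have h2 := Nat.mul_le_mul_left m (Nat.succ_le_of_lt hlt)
    simp only [r, Nat.mul_succ] at h h2
    omega
  have hinj : Function.Injective r := by
    intro x y h
    have h1 := le_antisymm (hr x y h.le) (hr y x h.ge)
    simp only [r, h1] at h
    exact e.injective (Fin.ext (by omega))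
  refine ⟨r, fun x => {z | z ∈ D.bag (t x) ∧ r z < r x}, hinj, fun x z hz => hz.2,
    fun x y hxy hlt => ?_, fun x z z' hz hz' hlt => ?_, fun x => ?_⟩
  · obtain ⟨n, hx, hy⟩ := D.exists_edge_bag x y hxy
    exact ⟨key n x y hx hy (hr x y hlt.le), hlt⟩
  · exact ⟨key _ z z' hz.1 hz'.1 (hr z z' hlt.le), hlt⟩
  · have hx : x ∉ {z | z ∈ D.bag (t x) ∧ r z < r x} := fun h => lt_irrefl _ h.2
    have h1 : insert x {z | z ∈ D.bag (t x) ∧ r z < r x} ⊆ D.bag (t x) :=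
      Set.insert_subset (ht x) fun z hz => hz.1
    have h2 := (Set.encard_le_encard h1).trans (hD (t x))
    rw [Set.encard_insert_of_notMem hx] at h2
    exact (ENat.add_le_add_iff_right (by simp)).1 h2

end TreeDecomposition

lemma exists_encard_bag_le {V : Type*} {G : SimpleGraph V} {k : ℕ} (h : treewidth G ≤ k) :
    ∃ D : TreeDecomposition G, ∀ u, (D.bag u).encard ≤ k + 1 := by
  have h1 : treewidth G < (k + 1 : ℕ) := h.trans_lt (by exact_mod_cast Nat.lt_succ_self k)
  obtain ⟨D, hD⟩ := iInf_lt_iff.1 h1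
  refine ⟨D, fun u => ?_⟩
  have h2 : D.width ≤ k := by
    rw [Nat.cast_add, Nat.cast_one] at hD
    exact Order.le_of_lt_add_one hD
  exact tsub_le_iff_right.1 ((le_iSup (fun u => (D.bag u).encard - 1) u).trans h2)

/-! ### The poset inside a 2-tree -/

/-- The elements of `P`, each with an element added below it and one added above it, and two
isolated elements. -/
inductive AugmentedVertex (P : Type*) where
  | first : AugmentedVertex P
  | second : AugmentedVertex P
  | base : P → AugmentedVertex P
  | lower : P → AugmentedVertex P
  | upper : P → AugmentedVertex P

namespace AugmentedVertex

variable {P : Type*}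

/-- Each element and its two leaves take three consecutive values, after those of the root edge. -/
def index (r : P → ℕ) : AugmentedVertex P → ℕ
  | first => 0
  | second => 1
  | base x => 3 * r x + 2
  | lower x => 3 * r x + 3
  | upper x => 3 * r x + 4

def parent (f : P → Option P) : AugmentedVertex P → AugmentedVertex P
  | first => first
  | second => second
  | base x => (f x).elim second base
  | lower x => base x
  | upper x => base x

/-- With fewer than two earlier neighbours, the attaching edge is completed: by the root edge if
there is none, and by the parent of the neighbour if there is one. -/
def coparent (f g : P → Option P) : AugmentedVertex P → AugmentedVertex P
  | first => first
  | second => second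
  | base x => (f x).elim first fun y => (g x).elim (parent f (base y)) base
  | lower x => parent f (base x)
  | upper x => parent f (base x)

/-- The relation whose reflexive transitive closure is the order extended to the augmented
vertices. -/
def Step [PartialOrder P] : AugmentedVertex P → AugmentedVertex P → Prop
  | lower x, base y => x = y
  | base x, base y => x ⋖ y
  | base x, upper y => x = y
  | _, _ => False

lemma le_iff_reflTransGen_step [PartialOrder P] [Finite P] (x y : P) :
    x ≤ y ↔ Relation.ReflTransGen Step (lower x) (upper y) := by
  classical
  constructor
  · intro h
    have := Fintype.ofFinite P
    let _ : LocallyFiniteOrder P := Fintype.toLocallyFiniteOrder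
    have h1 : Relation.ReflTransGen Step (base x) (base y) :=
      Relation.ReflTransGen.lift base (r := (· ⋖ ·)) (fun _ _ h => h) _ _ (le_iff_reflTransGen_covBy.1 h)
    exact (h1.head (show Step (lower x) (base x) from rfl)).tail
      (show Step (base y) (upper y) from rfl)
  · have key : ∀ z, Relation.ReflTransGen Step (lower x) z →
        z = lower x ∨ ∃ w, x ≤ w ∧ (z = base w ∨ z = upper w) := by
      intro z h
      induction h with
      | refl => exact Or.inl rfl
      | @tail b c _ h ih =>
        right
        rcases ih with rfl | ⟨w, hw, rfl | rfl⟩ <;> cases c <;> simp only [Step] at h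
        · exact ⟨_, h.le, Or.inl rfl⟩
        · exact ⟨_, hw.trans h.le, Or.inl rfl⟩
        · exact ⟨_, hw.trans h.le, Or.inr rfl⟩
    intro h
    rcases key _ h with h | ⟨w, hw, h | h⟩
    · cases h
    · cases h
    · cases h
      exact hw

/-- The functions `f` and `g` list the elements of the sets `N x`, which have at most two
elements; `f x` is the one with the larger value of `r`. -/
structure Lists (r : P → ℕ) (N : P → Set P) (f g : P → Option P) : Prop where
  subset : ∀ x, ∀ z ∈ N x, f x = some z ∨ g x = some z
  fst_mem : ∀ x, ∀ y ∈ f x, y ∈ N x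
  snd_mem : ∀ x, ∀ z ∈ g x, z ∈ N x ∧ ∃ y ∈ f x, r z < r y

lemma exists_lists [Finite P] {r : P → ℕ} (hr : Function.Injective r) {N : P → Set P}
    (hN : ∀ x, (N x).encard ≤ 2) : ∃ f g, Lists r N f g := by
  have : ∀ x, ∃ o o' : Option P, (∀ z ∈ N x, o = some z ∨ o' = some z) ∧ (∀ y ∈ o, y ∈ N x) ∧
      ∀ z ∈ o', z ∈ N x ∧ ∃ y ∈ o, r z < r y := by
    intro x
    rcases (N x).eq_empty_or_nonempty with h | h
    · exact ⟨none, none, by simp [h], by simp, by simp⟩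
    obtain ⟨y, hy, hmax⟩ := (N x).exists_max_image r (Set.toFinite _) h
    by_cases hz : ∃ z ∈ N x, z ≠ y
    · obtain ⟨z, hz, hzy⟩ := hz
      have hlt : r z < r y := (hmax z hz).lt_of_ne fun h => hzy (hr h)
      refine ⟨some y, some z, fun w hw => ?_, by simpa using hy, by simpa using ⟨hz, hlt⟩⟩
      by_contra! hcon
      have h3 : ({w, y, z} : Set P).encard = 3 := by
        rw [Set.encard_eq_three]
        exact ⟨w, y, z, fun h => hcon.1 (h ▸ rfl), fun h => hcon.2 (h ▸ rfl), hzy.symm, rfl⟩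
      have h4 : ({w, y, z} : Set P) ⊆ N x := by
        rintro v (rfl | rfl | rfl) <;> assumption
      have h5 := (Set.encard_le_encard h4).trans (hN x)
      rw [h3] at h5
      exact absurd h5 (by decide)
    · push Not at hz
      exact ⟨some y, none, fun w hw => Or.inl (by rw [hz w hw]), by simpa using hy, by simp⟩
  choose f g h using this
  exact ⟨f, g, fun x => (h x).1, fun x => (h x).2.1, fun x => (h x).2.2⟩

section Tree

variable {r : P → ℕ} {N : P → Set P} {f g : P → Option P}

lemma index_injective (hr : Function.Injective r) : Function.Injective (index r) := by
  intro a b h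
  cases a <;> cases b <;> simp only [index] at h <;>
    first
      | rfl
      | omega
      | (congr 1; exact hr (by omega))

lemma eq_parent_or_eq_coparent (h : Lists r N f g) {x z : P} (hz : z ∈ N x) :
    base z = parent f (base x) ∨ base z = coparent f g (base x) := by
  rcases h.subset x z hz with h1 | h1
  · exact Or.inl (by simp [parent, h1])
  · obtain ⟨-, y, hy, -⟩ := h.snd_mem x z h1
    rw [Option.mem_def] at hy
    exact Or.inr (by simp [coparent, h1, hy])

lemma index_parent_base_lt (h : Lists r N f g) (hlt : ∀ x, ∀ z ∈ N x, r z < r x) (x : P) :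
    index r (parent f (base x)) < 3 * r x + 2 := by
  cases hf : f x with
  | none => simp [parent, hf, index]
  | some y =>
    have := hlt x y (h.fst_mem x y hf)
    simp only [parent, hf, index, Option.elim_some]
    omega

/-- The 2-tree on the augmented vertices given by an elimination order. -/
def twoTree (hr : Function.Injective r) (h : Lists r N f g)
    (hlt : ∀ x, ∀ z ∈ N x, r z < r x)
    (hclique : ∀ x z z', z ∈ N x → z' ∈ N x → r z < r z' → z ∈ N z') :
    RootedTwoTree (AugmentedVertex P) where
  first := first
  second := second
  parent := parent f
  coparent := coparent f g
  index := index r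
  index_injective := index_injective hr
  first_ne_second := by simp
  index_parent_lt := by
    rintro (_ | _ | x | x | x) h1 h2
    · exact absurd rfl h1
    · exact absurd rfl h2
    · exact index_parent_base_lt h hlt x
    · simp [parent, index]
    · simp [parent, index]
  index_coparent_lt := by
    rintro (_ | _ | x | x | x) h1 h2
    · exact absurd rfl h1
    · exact absurd rfl h2
    · cases hf : f x with
      | none => simp [coparent, hf, index]
      | some y =>
        have hy := hlt x y (h.fst_mem x y hf)
        cases hg : g x with
        | none =>
          have := index_parent_base_lt h hlt y
          simp only [coparent, hf, hg, Option.elim_some, Option.elim_none]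
          rw [index.eq_3]
          omega
        | some z =>
          have := hlt x z (h.snd_mem x z hg).1
          simp only [coparent, hf, hg, index, Option.elim_some]
          omega
    · have := index_parent_base_lt h hlt x
      rw [coparent, index.eq_4]
      omega
    · have := index_parent_base_lt h hlt x
      rw [coparent, index.eq_5]
      omega
  parent_cases := by
    rintro (_ | _ | x | x | x) h1 h2
    · exact absurd rfl h1
    · exact absurd rfl h2
    · cases hf : f x with
      | none => exact Or.inl ⟨by simp [parent, hf], by simp [coparent, hf]⟩
      | some y =>
        right
        have hpar : parent f (base x) = base y := by simp [parent, hf]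
        rw [hpar]
        refine ⟨by simp, ?_⟩
        cases hg : g x with
        | none => exact Or.inl (by simp [coparent, hf, hg])
        | some z =>
          have hco : coparent f g (base x) = base z := by simp [coparent, hf, hg]
          rw [hco]
          obtain ⟨hz, y', hy', hlt'⟩ := h.snd_mem x z hg
          obtain rfl : y = y' := by simpa [hf] using hy'
          -- The earlier neighbours of `x` form a clique, so `z` is among those of `y`, that is, an
          -- end of the edge of `y`.
          exact eq_parent_or_eq_coparent h (hclique x z y hz (h.fst_mem x y hf) hlt')
    · exact Or.inr ⟨by simp [parent], Or.inl rfl⟩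
    · exact Or.inr ⟨by simp [parent], Or.inl rfl⟩

end Tree

end AugmentedVertex

theorem theorem1 {P : Type*} [PartialOrder P] [Finite P]
    (h : treewidth (SimpleGraph.hasse P) ≤ 2) : posetDimension P ≤ 12 := by
  obtain ⟨D, hD⟩ := exists_encard_bag_le (k := 2) h
  obtain ⟨r, N, hr, hlt, hadj, hclique, hcard⟩ := D.exists_elimination hD
  obtain ⟨f, g, hfg⟩ := AugmentedVertex.exists_lists hr hcard
  let S := AugmentedVertex.twoTree hr hfg hlt hclique
  have hinner : ∀ x, S.Inner (.base x) ∧ S.Inner (.lower x) ∧ S.Inner (.upper x) := fun x =>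
    ⟨⟨nofun, nofun⟩, ⟨nofun, nofun⟩, ⟨nofun, nofun⟩⟩
  have hstep : ∀ a b, AugmentedVertex.Step a b → S.Adj a b := by
    intro a b hab
    cases a <;> cases b <;> simp only [AugmentedVertex.Step] at hab
    · rename_i x y
      refine ⟨(hinner x).1, (hinner y).1, ?_⟩
      rcases lt_or_gt_of_ne (fun h => hab.ne (hr h) : r x ≠ r y) with h1 | h1
      · exact Or.inr (AugmentedVertex.eq_parent_or_eq_coparent hfg
          (hadj x y (SimpleGraph.hasse_adj.2 (Or.inl hab)) h1))
      · exact Or.inl (AugmentedVertex.eq_parent_or_eq_coparent hfg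
          (hadj y x (SimpleGraph.hasse_adj.2 (Or.inr hab)) h1))
    · subst hab
      exact ⟨(hinner _).1, (hinner _).2.2, Or.inr (Or.inl rfl)⟩
    · subst hab
      exact ⟨(hinner _).2.1, (hinner _).1, Or.inl (Or.inl rfl)⟩
  -- Nothing is attached to the added elements, so they are leaves of the tree.
  have hchild : ∀ v, S.Inner v → ∀ x, S.parent v ≠ .lower x ∧ S.parent v ≠ .upper x := by
    rintro (_ | _ | x | x | x) hv y
    · exact absurd rfl hv.1
    · exact absurd rfl hv.2
    · show AugmentedVertex.parent f (.base x) ≠ _ ∧ AugmentedVertex.parent f (.base x) ≠ _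
      cases hf : f x <;> simp [AugmentedVertex.parent, hf]
    · exact ⟨nofun, nofun⟩
    · exact ⟨nofun, nofun⟩
  refine RootedTwoTree.posetDimension_le (RootedTwoTree.separated_reflTransGen hstep)
    AugmentedVertex.lower AugmentedVertex.upper (fun a => ⟨(hinner a).2.1, fun z hz => ?_⟩)
    (fun a => ⟨(hinner a).2.2, fun z hz => ?_⟩) (fun _ _ => nofun)
    AugmentedVertex.le_iff_reflTransGen_step
  · by_contra hne
    obtain ⟨w, hw, hpw, -⟩ := hz.exists_child hne
    exact (hchild w hw a).1 hpw
  · by_contra hne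
    obtain ⟨w, hw, hpw, -⟩ := hz.exists_child hne
    exact (hchild w hw a).2 hpw
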